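/- Let $I(d)$ be the graph of the $d$-dimensional hypercube (vertices are the binary vectors of length $d$, adjacent when they differ in exactly one position). Let $k\ge 1$. A simple path or simple cycle $W$ in $I(d)$ has \emph{spread} $k$ if $d_{I(d)}(x,y)\ge\min\{d_W(x,y),k\}$ for all vertices $x,y$ of $W$, where $d_W$ is the distance measured inside $W$. A $(d,k)$ circuit code is a simple cycle in $I(d)$ of spread $k$; a spread-$k$ difference-preserving code is an open simple path of spread $k$. The length of a path or cycle is its number of edges. $K(d,k)$ is the maximum length of a $(d,k)$ circuit code. The transition sequence of a path or cycle lists, step by step, the single position in which consecutive vertices differ. Proposition. Fix $k\ge 1$, and put $d_i=2^i+2i+5k-4$ and $\hat d_i=d_i-k=2^i+2i+4k-4$. Then: (a) There is a constant $c=c(k)$ such that for every $i\ge 1$ there is a spread-$k$ difference-preserving code $P$ in $I(\hat d_i)$ of length $N\ge 2^{\hat d_i-(2+k)i-c}$. (b) For every $i\ge1$ and every spread-$k$ difference-preserving code $P$ in $I(\hat d_i)$ of length $N\ge 1$ with transition sequence $T(P)$, the sequence $$(T(P),\hat d_i+1,\ldots,\hat d_i+k,\;T(P),\hat d_i+1,\ldots,\hat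 d_i+k)$$ is the transition sequence of a $(d_i,k)$ circuit code of length $2(N+k)$ starting at $\vec 0$. In particular $K(d_i,k)\ge 2(N+k)$. (c) The sequence $(d_i)$ is strictly increasing, and $$\lim_{i\to\infty}\frac{\log_2 K(d_i,k)}{d_i}=1 .$$ -/

import Mathlib

namespace CircuitCode

/-- The graph `I(d)` of the `d`-dimensional hypercube: the vertices are the binary vectors of
length `d`, two of them being adjacent when they differ in exactly one position. -/
def hypercube (d : ℕ) : SimpleGraph (Fin d → ZMod 2) where
  Adj x y := hammingDist x y = 1
  symm := ⟨fun x y h => by rw [hammingDist_comm]; exact h⟩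
  loopless := ⟨fun x h => by simp at h⟩

/-- The distance between two vertices of a walk `w`, measured inside the subgraph that consists
of the vertices and edges of `w` (the distance `d_C` of a cycle, or `d_P` of a path). -/
noncomputable def walkDist {d : ℕ} {u v : Fin d → ZMod 2} (w : (hypercube d).Walk u v)
    (x y : Fin d → ZMod 2) : ℕ :=
  w.toSubgraph.spanningCoe.dist x y

/-- The spread `k` condition `d_{I(d)}(x, y) ≥ min {d_w(x, y), k}` for all vertices of `w`. -/
def HasSpread {d : ℕ} {u v : Fin d → ZMod 2} (k : ℕ) (w : (hypercube d).Walk u v) : Prop :=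
  ∀ x ∈ w.support, ∀ y ∈ w.support, min (walkDist w x y) k ≤ (hypercube d).dist x y

/-- A `(d, k)` circuit code: a simple cycle of `I(d)` with spread `k`. -/
def IsCircuitCode {d : ℕ} {u : Fin d → ZMod 2} (k : ℕ) (C : (hypercube d).Walk u u) : Prop :=
  C.IsCycle ∧ HasSpread k C

/-- A difference-preserving code of spread `k`: an open path of `I(d)` with spread `k`. -/
def IsDifferencePreserving {d : ℕ} {u v : Fin d → ZMod 2} (k : ℕ)
    (P : (hypercube d).Walk u v) : Prop :=
  P.IsPath ∧ HasSpread k P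

/-- `τ` is the transition sequence of `w`: its `j`-th entry is the single position in which the
endpoints of the `j`-th step of `w` differ. -/
def IsTransitionSeq {d : ℕ} {u v : Fin d → ZMod 2} (w : (hypercube d).Walk u v)
    (τ : List (Fin d)) : Prop :=
  List.Forall₂ (fun e t => ∀ j, e.fst j ≠ e.snd j ↔ j = t) w.darts τ

/-- The sequence `(τ, n+1, …, n+k)` over the positions of `I(n+k)`, for a sequence `τ` of
positions of `I(n)`. -/
def appendNew {n : ℕ} (k : ℕ) (τ : List (Fin n)) : List (Fin (n + k)) :=
  τ.map (Fin.castAdd k) ++ (List.finRange k).map (Fin.natAdd n)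

/-- The lengths of all `(d, k)` circuit codes. -/
def circuitLengths (d k : ℕ) : Set ℕ :=
  {n | ∃ (u : Fin d → ZMod 2) (C : (hypercube d).Walk u u), IsCircuitCode k C ∧ C.length = n}

theorem bddAbove_circuitLengths (d k : ℕ) : BddAbove (circuitLengths d k) := by
  refine ⟨Fintype.card (Fin d → ZMod 2), ?_⟩
  rintro n ⟨u, C, hC, rfl⟩
  have h := hC.1.support_nodup.length_le_card
  simpa using h

/-- `K(d, k)`, the maximum length of a `(d, k)` circuit code (the maximum exists as soon as there
is such a code, because the set of lengths is bounded; it is `0` if there is none). -/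
noncomputable def K (d k : ℕ) : ℕ := sSup (circuitLengths d k)

/-- The dimension `d_i = 2^i + 2i + 5k - 4` (used for `k ≥ 1` only, so nothing is truncated). -/
def circuitDim (k i : ℕ) : ℕ := 2 ^ i + 2 * i + 5 * k - 4

/-- The dimension `d_i - k = 2^i + 2i + 4k - 4`. -/
def pathDim (k i : ℕ) : ℕ := 2 ^ i + 2 * i + 4 * k - 4

end CircuitCode

namespace CircuitCode

open SimpleGraph

/-! ### Hamming distance as distance in the hypercube -/

variable {d : ℕ}

/-! The long path carries `m` message bits and `R = k + M + k` parity bits. The messages run through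
a Gray code `x`. After each change of a message bit `t j`, the parity bits, a linear function of the
message, are brought up to date one at a time from left to right, pausing where a bit is already
right. Each column of the linear map consists of `M` inner bits between two blocks of `k` ones.

Compare two vertices. If their messages are at least two Gray steps apart, the messages differ in
some bit `T` other than the two bits being processed. Either they differ in at least `k` bits, or
the inner parity bits differ by `h T` plus few other columns and two tails, which has weight at
least `k` by `ColumnsSpread`. If the messages are one step apart, a parity update beyond the
progress of the earlier vertex gives distance at least `k`, mostly through a block of ones; any
other update moves away from the earlier vertex. This is what
`exists_isDifferencePreserving_of_lazy` needs.

Columns with `ColumnsSpread` exist by a union bound: about `m ^ (k + 1)` times a polynomial in `M`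
bad events, each of probability polynomial in `M` over `2 ^ M`. For `m ≤ 2 ^ i`, the choice `M = (k
+ 2) * i` suffices for large `i`. The path has at least `2 ^ m - 2` edges, where `m` equals the
dimension minus `(k + 2) * i + 2 * k`.

To close a path into a circuit, its transitions and `k` new ones are run twice, so the second half
is a translate of the first. The `k` new coordinates separate the halves
(`exists_isCircuitCode_appendNew`). The limit follows by squeezing, since `K ≤ 2 ^ d` and `i / 2 ^
i` tends to `0`. -/

theorem hammingDist_eq_sum {ι : Type*} [Fintype ι] (x y : ι → ZMod 2) :
    hammingDist x y = ∑ i, if x i ≠ y i then 1 else 0 := by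
  rw [hammingDist, Finset.card_filter]

theorem hammingDist_append {m r : ℕ} (x x' : Fin m → ZMod 2) (s s' : Fin r → ZMod 2) :
    hammingDist (Fin.append x s) (Fin.append x' s') = hammingDist x x' + hammingDist s s' := by
  simp only [hammingDist_eq_sum, Fin.sum_univ_add, Fin.append_left, Fin.append_right]

theorem hammingDist_add_right {ι : Type*} [Fintype ι] (x y z : ι → ZMod 2) :
    hammingDist (x + z) (y + z) = hammingDist x y := by
  simp [hammingDist]

theorem hammingDist_add_left {ι : Type*} [Fintype ι] (x y z : ι → ZMod 2) :
    hammingDist (z + x) (z + y) = hammingDist x y := by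
  simp [hammingDist]

theorem hammingDist_comp_injective_le {ι κ : Type*} [Fintype ι] [Fintype κ] (e : ι → κ)
    (he : Function.Injective e) (x y : κ → ZMod 2) :
    hammingDist (x ∘ e) (y ∘ e) ≤ hammingDist x y := by
  classical
  rw [hammingDist, hammingDist, ← Finset.card_image_of_injective _ he]
  refine Finset.card_le_card fun j hj => ?_
  simp only [Finset.mem_image, Finset.mem_filter, Finset.mem_univ, true_and] at hj ⊢
  obtain ⟨i, hi, rfl⟩ := hj
  exact hi

theorem zmod_two_ne_iff (a b : ZMod 2) : a ≠ b ↔ b = a + 1 := by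
  revert a b; decide

theorem differ_only_iff (x y : Fin d → ZMod 2) (t : Fin d) :
    (∀ j, x j ≠ y j ↔ j = t) ↔ y = x + Pi.single t 1 := by
  constructor
  · intro h
    funext j
    by_cases hj : j = t
    · subst hj
      simpa [zmod_two_ne_iff] using (h j).2 rfl
    · have := mt (h j).1 hj
      simp only [ne_eq, not_not] at this
      simp [hj, this]
  · rintro rfl j
    by_cases hj : j = t
    · subst hj
      simp
    · simp [hj]

theorem hammingDist_add_single (x : Fin d → ZMod 2) (t : Fin d) :
    hammingDist x (x + Pi.single t 1) = 1 := by
  have h := (differ_only_iff x _ t).2 rfl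
  simp only [hammingDist, h, Finset.filter_eq', Finset.mem_univ, if_true, Finset.card_singleton]

theorem exists_add_single_of_hammingDist_eq_one {x y : Fin d → ZMod 2}
    (h : hammingDist x y = 1) : ∃ t, y = x + Pi.single t 1 := by
  rw [hammingDist, Finset.card_eq_one] at h
  obtain ⟨t, ht⟩ := h
  refine ⟨t, (differ_only_iff x y t).1 fun j => ?_⟩
  simpa using Finset.ext_iff.1 ht j

theorem hammingDist_le_length {x y : Fin d → ZMod 2} (w : (hypercube d).Walk x y) :
    hammingDist x y ≤ w.length := by
  induction w with
  | nil => simp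
  | cons h p ih =>
    rw [Walk.length_cons]
    have h1 : hammingDist _ _ = 1 := h
    have := hammingDist_triangle _ _ _ |>.trans (Nat.add_le_add h1.le ih)
    omega

theorem exists_walk_length_eq_hammingDist (x y : Fin d → ZMod 2) :
    ∃ w : (hypercube d).Walk x y, w.length = hammingDist x y := by
  induction h : hammingDist x y generalizing x with
  | zero =>
    obtain rfl := hammingDist_eq_zero.1 h
    exact ⟨.nil, rfl⟩
  | succ n ih =>
    have hne : x ≠ y := by rintro rfl; simp at h
    obtain ⟨t, ht⟩ := Function.ne_iff.1 hne
    have hsum : hammingDist (x + Pi.single t 1) y = n := by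
      have hy : y t = x t + 1 := (zmod_two_ne_iff _ _).1 ht
      have : (Finset.univ.filter fun i => (x + Pi.single t 1 : Fin d → ZMod 2) i ≠ y i) =
          (Finset.univ.filter fun i => x i ≠ y i).erase t := by
        ext j
        by_cases hj : j = t
        · subst hj; simp [hy]
        · simp [hj]
      rw [hammingDist, this, Finset.card_erase_of_mem (by simpa using ht)]
      rw [hammingDist] at h
      omega
    obtain ⟨w, hw⟩ := ih _ hsum
    have hadj : (hypercube d).Adj x (x + Pi.single t 1) := hammingDist_add_single x t
    exact ⟨.cons hadj w, by simp [hw]⟩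

theorem hypercube_dist (x y : Fin d → ZMod 2) : (hypercube d).dist x y = hammingDist x y := by
  obtain ⟨w, hw⟩ := exists_walk_length_eq_hammingDist x y
  refine le_antisymm (hw ▸ SimpleGraph.dist_le w) ?_
  obtain ⟨w', hw'⟩ := w.reachable.exists_walk_length_eq_dist
  exact hw' ▸ hammingDist_le_length w'

/-! ### Distance inside a walk, and criteria for spread -/

theorem exists_walk_spanningCoe {u v : Fin d → ZMod 2} (w : (hypercube d).Walk u v) {a b : ℕ}
    (hab : a ≤ b) (hb : b ≤ w.length) :
    ∃ q : w.toSubgraph.spanningCoe.Walk (w.getVert a) (w.getVert b), q.length = b - a := by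
  induction b, hab using Nat.le_induction with
  | base => exact ⟨.nil, by simp⟩
  | succ b hab ih =>
    obtain ⟨q, hq⟩ := ih (by omega)
    have hadj : w.toSubgraph.spanningCoe.Adj (w.getVert b) (w.getVert (b + 1)) :=
      w.toSubgraph_adj_getVert (by omega)
    exact ⟨q.concat hadj, by rw [Walk.length_concat, hq]; omega⟩

theorem walkDist_getVert_le {u v : Fin d → ZMod 2} (w : (hypercube d).Walk u v) {a b : ℕ}
    (hab : a ≤ b) (hb : b ≤ w.length) : walkDist w (w.getVert a) (w.getVert b) ≤ b - a := by
  obtain ⟨q, hq⟩ := exists_walk_spanningCoe w hab hb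
  exact hq ▸ SimpleGraph.dist_le q

theorem walkDist_comm {u v : Fin d → ZMod 2} (w : (hypercube d).Walk u v)
    (x y : Fin d → ZMod 2) : walkDist w x y = walkDist w y x :=
  SimpleGraph.dist_comm

theorem walkDist_getVert_le_around {u : Fin d → ZMod 2} (w : (hypercube d).Walk u u) {a b : ℕ}
    (hab : a ≤ b) (hb : b ≤ w.length) :
    walkDist w (w.getVert a) (w.getVert b) ≤ w.length - (b - a) := by
  obtain ⟨q, hq⟩ := exists_walk_spanningCoe w (Nat.zero_le a) (hab.trans hb)
  obtain ⟨q', hq'⟩ := exists_walk_spanningCoe w hb le_rfl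
  have h0 : w.getVert w.length = w.getVert 0 := by simp
  refine (SimpleGraph.dist_le (q.reverse.append ((q'.copy rfl h0).reverse))).trans ?_
  simp only [Walk.length_append, Walk.length_reverse, Walk.length_copy, hq, hq']
  omega

/-- On a path the index of a vertex is unique, so each edge of the subgraph changes it by exactly
one. Only this lower bound lets the spread hypothesis on a given path be used; proving spread needs
upper bounds alone. -/
theorem le_walkDist_getVert {u v : Fin d → ZMod 2} {w : (hypercube d).Walk u v} (hw : w.IsPath)
    {a b : ℕ} (hab : a ≤ b) (hb : b ≤ w.length) :
    b - a ≤ walkDist w (w.getVert a) (w.getVert b) := by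
  have key : ∀ (x y : Fin d → ZMod 2) (q : w.toSubgraph.spanningCoe.Walk x y) (i j : ℕ),
      i ≤ w.length → j ≤ w.length → w.getVert i = x → w.getVert j = y → j ≤ i + q.length := by
    intro x y q
    induction q with
    | nil =>
      intro i j hi hj hx hy
      have := hw.getVert_injOn hi hj (hx.trans hy.symm)
      omega
    | cons h q ih =>
      intro i j hi hj hx hy
      have h' := h
      rw [Subgraph.spanningCoe_adj, Walk.toSubgraph_adj_iff] at h'
      obtain ⟨l, hl, hlt⟩ := h'
      rw [Walk.length_cons]
      rcases Sym2.eq_iff.1 hl with ⟨h1, h2⟩ | ⟨h1, h2⟩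
      · have := hw.getVert_injOn hi hlt.le (hx.trans h1.symm)
        have := ih (l + 1) j hlt hj h2 hy
        omega
      · have := hw.getVert_injOn hi (show l + 1 ≤ w.length from hlt) (hx.trans h2.symm)
        have := ih l j hlt.le hj h1 hy
        omega
  obtain ⟨q, -⟩ := exists_walk_spanningCoe w hab hb
  obtain ⟨q', hq'⟩ := q.reachable.exists_walk_length_eq_dist
  have := key _ _ q' a b (hab.trans hb) hb rfl rfl
  rw [walkDist, ← hq']
  omega

theorem IsDifferencePreserving.min_le_hammingDist {k : ℕ} {u v : Fin d → ZMod 2}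
    {P : (hypercube d).Walk u v} (hP : IsDifferencePreserving k P) {a b : ℕ}
    (hab : a ≤ b) (hb : b ≤ P.length) :
    min (b - a) k ≤ hammingDist (P.getVert a) (P.getVert b) := by
  rw [← hypercube_dist]
  refine le_trans ?_ (hP.2 _ (P.getVert_mem_support a) _ (P.getVert_mem_support b))
  exact min_le_min_right _ (le_walkDist_getVert hP.1 hab hb)

theorem exists_walk_of_steps (N : ℕ) (f : ℕ → Fin d → ZMod 2)
    (hf : ∀ a < N, hammingDist (f a) (f (a + 1)) = 1) :
    ∃ w : (hypercube d).Walk (f 0) (f N), w.length = N ∧ ∀ a ≤ N, w.getVert a = f a := by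
  induction N generalizing f with
  | zero => exact ⟨.nil, rfl, fun a ha => by simp [Nat.le_zero.1 ha]⟩
  | succ N ih =>
    obtain ⟨w, hw, hv⟩ := ih (fun a => f (a + 1)) fun a ha => hf (a + 1) (by omega)
    have hadj : (hypercube d).Adj (f 0) (f (0 + 1)) := hf 0 (by omega)
    refine ⟨.cons hadj w, by simp [hw], fun a ha => ?_⟩
    cases a with
    | zero => simp
    | succ a => rw [Walk.getVert_cons_succ, hv a (by omega)]

theorem isDifferencePreserving_of_getVert {k : ℕ} (hk : 1 ≤ k) {u v : Fin d → ZMod 2}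
    (w : (hypercube d).Walk u v)
    (hw : ∀ a b, a ≤ b → b ≤ w.length →
      min (b - a) k ≤ hammingDist (w.getVert a) (w.getVert b)) :
    IsDifferencePreserving k w := by
  constructor
  · rw [← Walk.IsPath.getVert_injOn_iff]
    have : ∀ a b, a ≤ b → b ≤ w.length → w.getVert a = w.getVert b → a = b := by
      intro a b hab hb h
      have := hw a b hab hb
      rw [h, hammingDist_self] at this
      omega
    intro a ha b hb h
    rcases le_total a b with hab | hab
    · exact this a b hab hb h
    · exact (this b a hab ha h.symm).symm
  · intro x hx y hy
    obtain ⟨a, rfl, ha⟩ := Walk.mem_support_iff_exists_getVert.1 hx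
    obtain ⟨b, rfl, hb⟩ := Walk.mem_support_iff_exists_getVert.1 hy
    have : ∀ a b, a ≤ b → b ≤ w.length → min (walkDist w (w.getVert a) (w.getVert b)) k ≤
        (hypercube d).dist (w.getVert a) (w.getVert b) := by
      intro a b hab hb
      rw [hypercube_dist]
      exact (min_le_min_right _ (walkDist_getVert_le w hab hb)).trans (hw a b hab hb)
    rcases le_total a b with hab | hab
    · exact this a b hab hb
    · rw [walkDist_comm, SimpleGraph.dist_comm]
      exact this b a hab ha

theorem exists_isDifferencePreserving_of_seq {k : ℕ} (hk : 1 ≤ k) (N : ℕ)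
    (f : ℕ → Fin d → ZMod 2) (hf : ∀ a < N, hammingDist (f a) (f (a + 1)) = 1)
    (hs : ∀ a b, a ≤ b → b ≤ N → min (b - a) k ≤ hammingDist (f a) (f b)) :
    ∃ (u v : Fin d → ZMod 2) (P : (hypercube d).Walk u v),
      IsDifferencePreserving k P ∧ P.length = N := by
  obtain ⟨w, hw, hv⟩ := exists_walk_of_steps N f hf
  refine ⟨_, _, w, isDifferencePreserving_of_getVert hk w fun a b hab hb => ?_, hw⟩
  rw [hw] at hb
  rw [hv a (hab.trans hb), hv b hb]
  exact hs a b hab hb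

/-- A sequence that is allowed to pause, and each of whose steps either moves away from an
earlier vertex or ends far from it, gives a difference-preserving code. -/
theorem exists_isDifferencePreserving_of_lazy {k : ℕ} (hk : 1 ≤ k) (L : ℕ)
    (g : ℕ → Fin d → ZMod 2) (hg : ∀ a < L, hammingDist (g a) (g (a + 1)) ≤ 1)
    (hs : ∀ a b, a ≤ b → b < L → k ≤ hammingDist (g a) (g (b + 1)) ∨
      hammingDist (g a) (g (b + 1)) = hammingDist (g a) (g b) + hammingDist (g b) (g (b + 1))) :
    ∃ (u v : Fin d → ZMod 2) (P : (hypercube d).Walk u v),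
      IsDifferencePreserving k P ∧
        P.length = ∑ a ∈ Finset.range L, hammingDist (g a) (g (a + 1)) := by
  set l : ℕ → ℕ := fun n => ∑ a ∈ Finset.range n, hammingDist (g a) (g (a + 1)) with hl
  have hl1 : ∀ n, l (n + 1) = l n + hammingDist (g n) (g (n + 1)) := fun n =>
    Finset.sum_range_succ _ _
  have hmono : Monotone l := monotone_nat_of_le_succ fun n => by rw [hl1]; omega
  have hub : ∀ a b, a ≤ b → hammingDist (g a) (g b) ≤ l b - l a := by
    intro a b hab
    induction b, hab using Nat.le_induction with
    | base => simp
    | succ b hab ih =>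
      have := hammingDist_triangle (g a) (g b) (g (b + 1))
      have := hmono hab
      rw [hl1]
      omega
  -- Here `l` counts the steps that are not pauses. A step either lands at distance at least `k` or
  -- adds its own length.
  have hlb : ∀ a b, a ≤ b → b ≤ L → min (l b - l a) k ≤ hammingDist (g a) (g b) := by
    intro a b hab
    induction b, hab using Nat.le_induction with
    | base => simp
    | succ b hab ih =>
      intro hb
      have := ih (by omega)
      have := hmono hab
      rcases hs a b hab (by omega) with h | h
      · exact (min_le_right _ _).trans h
      · rw [hl1, h]
        omega
  -- Discrete intermediate values: `l` grows by at most one per step, so a section `σ` of `l`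
  -- deletes the pauses.
  have hsurj : ∀ M, M ≤ L → ∀ n, n ≤ l M → ∃ a, a ≤ M ∧ l a = n := by
    intro M
    induction M with
    | zero => intro _ n hn; exact ⟨0, le_rfl, by simp [hl] at hn ⊢; omega⟩
    | succ M ih =>
      intro hM n hn
      rcases Nat.lt_or_ge (l M) n with h | h
      · refine ⟨M + 1, le_rfl, ?_⟩
        have := hg M (by omega)
        rw [hl1] at hn ⊢
        omega
      · obtain ⟨a, ha, h'⟩ := ih (by omega) n h
        exact ⟨a, by omega, h'⟩
  have hch : ∀ n, ∃ a, n ≤ l L → a ≤ L ∧ l a = n := by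
    intro n
    by_cases hn : n ≤ l L
    · obtain ⟨a, ha⟩ := hsurj L le_rfl n hn
      exact ⟨a, fun _ => ha⟩
    · exact ⟨0, fun h => absurd h hn⟩
  choose σ hσ using hch
  have hle : ∀ a b, a < b → b ≤ l L → σ a ≤ σ b := by
    intro a b hab hb
    by_contra! hcon
    have := hmono hcon.le
    rw [(hσ a (by omega)).2, (hσ b hb).2] at this
    omega
  refine exists_isDifferencePreserving_of_seq hk (l L) (fun n => g (σ n)) ?_ ?_
  · intro a ha
    have h1 := hle a (a + 1) (by omega) (by omega)
    have h2 := hub _ _ h1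
    have h3 := hlb _ _ h1 (hσ (a + 1) (by omega)).1
    rw [(hσ a (by omega)).2, (hσ (a + 1) (by omega)).2] at h2 h3
    show hammingDist (g (σ a)) (g (σ (a + 1))) = 1
    omega
  · intro a b hab hb
    rcases hab.eq_or_lt with rfl | hab
    · simp
    · have h3 := hlb _ _ (hle a b hab hb) (hσ b hb).1
      rwa [(hσ a (by omega)).2, (hσ b hb).2] at h3

theorem isCircuitCode_of_getVert {k : ℕ} (hk : 1 ≤ k) {u : Fin d → ZMod 2}
    (C : (hypercube d).Walk u u) (h3 : 3 ≤ C.length)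
    (hC : ∀ a b, a ≤ b → b < C.length →
      min (min (b - a) (C.length - (b - a))) k ≤ hammingDist (C.getVert a) (C.getVert b)) :
    IsCircuitCode k C := by
  have hinj : ∀ a b, a < b → b < C.length → C.getVert a ≠ C.getVert b := by
    intro a b hab hb h
    have := hC a b hab.le hb
    rw [h, hammingDist_self] at this
    omega
  constructor
  · cases C with
    | nil => simp at h3
    | @cons _ v _ h p =>
      rw [Walk.length_cons] at h3 hinj
      have hp : p.IsPath := by
        rw [← Walk.IsPath.getVert_injOn_iff]
        have key : ∀ a b, a < b → b ≤ p.length → p.getVert a ≠ p.getVert b := by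
          intro a b hab hb he
          rcases hb.lt_or_eq with hb | rfl
          · exact hinj (a + 1) (b + 1) (by omega) (by omega) (by simpa using he)
          · refine hinj 0 (a + 1) (by omega) (by omega) ?_
            simpa using he.symm
        intro a ha b hb he
        rcases lt_trichotomy a b with hab | hab | hab
        · exact absurd he (key a b hab hb)
        · exact hab
        · exact absurd he.symm (key b a hab ha)
      -- If the closing edge lay on `p`, its two ends would be consecutive on `p`, whose length is
      -- at least 2.
      refine (Walk.cons_isCycle_iff p h).2 ⟨hp, fun he => ?_⟩
      obtain ⟨i, hi, hs⟩ := p.mk_mem_edges_iff_exists.1 he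
      rcases Sym2.eq_iff.1 hs with ⟨h1, -⟩ | ⟨h1, h2⟩
      · have := hp.getVert_injOn hi.le (le_refl p.length) (h1.trans p.getVert_length.symm)
        omega
      · have e1 := hp.getVert_injOn hi.le (Nat.zero_le p.length) (h1.trans p.getVert_zero.symm)
        have e2 := hp.getVert_injOn (show i + 1 ≤ p.length from hi) (le_refl p.length)
          (h2.trans p.getVert_length.symm)
        omega
  · have key : ∀ a b, a ≤ b → b < C.length →
        min (walkDist C (C.getVert a) (C.getVert b)) k ≤
          (hypercube d).dist (C.getVert a) (C.getVert b) := by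
      intro a b hab hb
      rw [hypercube_dist]
      refine le_trans (min_le_min_right _ (le_min ?_ ?_)) (hC a b hab hb)
      · exact walkDist_getVert_le C hab hb.le
      · exact walkDist_getVert_le_around C hab hb.le
    have hex : ∀ x ∈ C.support, ∃ a < C.length, C.getVert a = x := by
      intro x hx
      obtain ⟨a, rfl, ha⟩ := Walk.mem_support_iff_exists_getVert.1 hx
      rcases ha.lt_or_eq with ha | rfl
      · exact ⟨a, ha, rfl⟩
      · exact ⟨0, by omega, by simp⟩
    intro x hx y hy
    obtain ⟨a, ha, rfl⟩ := hex x hx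
    obtain ⟨b, hb, rfl⟩ := hex y hy
    rcases le_total a b with hab | hab
    · exact key a b hab hb
    · rw [walkDist_comm, SimpleGraph.dist_comm]
      exact key b a hab ha

/-! ### Transition sequences and the closing of a path into a circuit -/

/-- The sum of the first `a` unit vectors named by the transition sequence `τ`. -/
def partialSum (τ : List (Fin d)) (a : ℕ) : Fin d → ZMod 2 :=
  ((τ.take a).map fun t => (Pi.single t 1 : Fin d → ZMod 2)).sum

theorem partialSum_zero (τ : List (Fin d)) : partialSum τ 0 = 0 := by
  simp [partialSum]

theorem partialSum_cons_succ (t : Fin d) (τ : List (Fin d)) (a : ℕ) :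
    partialSum (t :: τ) (a + 1) = Pi.single t 1 + partialSum τ a := by
  simp [partialSum]

theorem partialSum_of_length_le (τ : List (Fin d)) {a : ℕ} (ha : τ.length ≤ a) :
    partialSum τ a = partialSum τ τ.length := by
  simp [partialSum, List.take_of_length_le ha]

theorem partialSum_append (τ τ' : List (Fin d)) (a : ℕ) :
    partialSum (τ ++ τ') a = partialSum τ a + partialSum τ' (a - τ.length) := by
  simp [partialSum, List.take_append]

theorem IsTransitionSeq.getVert_eq {u v : Fin d → ZMod 2} {w : (hypercube d).Walk u v}
    {τ : List (Fin d)} (h : IsTransitionSeq w τ) :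
    τ.length = w.length ∧ ∀ a ≤ w.length, w.getVert a = u + partialSum τ a := by
  induction w generalizing τ with
  | nil =>
    cases τ with
    | nil => simp [partialSum]
    | cons t τ => simp [IsTransitionSeq] at h
  | cons hadj p ih =>
    cases τ with
    | nil => simp [IsTransitionSeq] at h
    | cons t τ =>
      rw [IsTransitionSeq, Walk.darts_cons, List.forall₂_cons] at h
      obtain ⟨h1, h2⟩ := h
      obtain ⟨hl, hv⟩ := ih h2
      refine ⟨by simp [hl], fun a ha => ?_⟩
      cases a with
      | zero => simp [partialSum_zero]
      | succ a =>
        have h1' := (differ_only_iff _ _ t).1 h1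
        rw [Walk.length_cons] at ha
        rw [Walk.getVert_cons_succ, hv a (by omega), partialSum_cons_succ, ← add_assoc]
        exact congrArg (· + partialSum τ a) h1'

theorem exists_isTransitionSeq (τ : List (Fin d)) (u : Fin d → ZMod 2) :
    ∃ (v : Fin d → ZMod 2) (w : (hypercube d).Walk u v), IsTransitionSeq w τ := by
  induction τ generalizing u with
  | nil => exact ⟨u, .nil, by simp [IsTransitionSeq]⟩
  | cons t τ ih =>
    obtain ⟨v, w, hw⟩ := ih (u + Pi.single t 1)
    have hadj : (hypercube d).Adj u (u + Pi.single t 1) := hammingDist_add_single u t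
    refine ⟨v, .cons hadj w, ?_⟩
    rw [IsTransitionSeq, Walk.darts_cons, List.forall₂_cons]
    exact ⟨(differ_only_iff _ _ t).2 rfl, hw⟩

theorem append_add_append {m r : ℕ} (x x' : Fin m → ZMod 2) (s s' : Fin r → ZMod 2) :
    Fin.append x s + Fin.append x' s' = Fin.append (x + x') (s + s') := by
  funext i
  refine Fin.addCases (fun i => ?_) (fun i => ?_) i <;> simp

/-- The vector whose first `b` entries are one and whose other entries are zero. -/
def initialOnes (k b : ℕ) : Fin k → ZMod 2 := fun q => if (q : ℕ) < b then 1 else 0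

theorem partialSum_map_castAdd {n : ℕ} (k : ℕ) (τ : List (Fin n)) (a : ℕ) :
    partialSum (τ.map (Fin.castAdd k)) a = Fin.append (partialSum τ a) 0 := by
  induction τ generalizing a with
  | nil =>
    funext i
    refine Fin.addCases (fun i => ?_) (fun i => ?_) i <;> simp [partialSum]
  | cons t τ ih =>
    cases a with
    | zero =>
      funext i
      refine Fin.addCases (fun i => ?_) (fun i => ?_) i <;> simp [partialSum]
    | succ a =>
      have : (Pi.single (Fin.castAdd k t) 1 : Fin (n + k) → ZMod 2) =
          Fin.append (Pi.single t 1) 0 := by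
        funext i
        refine Fin.addCases (fun i => ?_) (fun i => ?_) i
        · simp [Pi.single_apply]
        · simp [Pi.single_apply, Fin.ext_iff]
          omega
      rw [List.map_cons, partialSum_cons_succ, ih, this, append_add_append, partialSum_cons_succ,
        add_zero]

theorem partialSum_apply (τ : List (Fin d)) (hτ : τ.Nodup) (a : ℕ) (j : Fin d) :
    partialSum τ a j = if j ∈ τ.take a then 1 else 0 := by
  induction τ generalizing a with
  | nil => simp [partialSum]
  | cons t τ ih =>
    cases a with
    | zero => simp [partialSum]
    | succ a =>
      rw [List.nodup_cons] at hτ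
      rw [partialSum_cons_succ, Pi.add_apply, ih hτ.2, List.take_succ_cons]
      simp only [List.mem_cons]
      by_cases hj : j = t
      · subst hj
        simp [show j ∉ τ.take a from fun h => hτ.1 (List.mem_of_mem_take h)]
      · simp [hj]

theorem partialSum_map_natAdd {n : ℕ} (k : ℕ) (b : ℕ) :
    partialSum ((List.finRange k).map (Fin.natAdd n)) b = Fin.append 0 (initialOnes k b) := by
  funext i
  rw [partialSum_apply _ ((List.nodup_finRange k).map (Fin.natAdd_injective k n))]
  refine Fin.addCases (fun i => ?_) (fun i => ?_) i
  · simp only [Fin.append_left, Pi.zero_apply, ite_eq_right_iff]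
    intro h
    obtain ⟨j, -, hj⟩ := List.mem_map.1 (List.mem_of_mem_take h)
    rw [Fin.ext_iff] at hj
    simp at hj
    omega
  · simp only [Fin.append_right, initialOnes]
    congr 1
    rw [← List.map_take, List.mem_map_of_injective (Fin.natAdd_injective k n),
      List.mem_take_iff_getElem]
    simp only [List.getElem_finRange, eq_iff_iff]
    constructor
    · rintro ⟨j, hj, rfl⟩
      simp at hj ⊢
      omega
    · intro h
      exact ⟨i, by simp [h], by simp⟩

theorem partialSum_appendNew {n : ℕ} (k : ℕ) (τ : List (Fin n)) (a : ℕ) :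
    partialSum (appendNew k τ) a =
      Fin.append (partialSum τ a) (initialOnes k (a - τ.length)) := by
  rw [appendNew, partialSum_append, partialSum_map_castAdd, partialSum_map_natAdd,
    append_add_append, List.length_map, zero_add, add_zero]

theorem hammingDist_initialOnes {k b c : ℕ} (hbc : b ≤ c) (hc : c ≤ k) :
    hammingDist (initialOnes k b) (initialOnes k c) = c - b := by
  have : ∀ q : Fin k, (initialOnes k b q ≠ initialOnes k c q) ↔ b ≤ (q : ℕ) ∧ (q : ℕ) < c := by
    intro q
    simp only [initialOnes]
    split_ifs <;> simp <;> omega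
  simp only [hammingDist, this]
  rw [← Nat.card_Ico b c]
  refine Finset.card_bij (fun q _ => (q : ℕ)) (by simp) (fun x _ y _ h => Fin.ext h) ?_
  intro x hx
  rw [Finset.mem_Ico] at hx
  exact ⟨⟨x, by omega⟩, by simpa using hx, rfl⟩

theorem hammingDist_add_one_right {ι : Type*} [Fintype ι] (x y : ι → ZMod 2) :
    hammingDist x (y + 1) = Fintype.card ι - hammingDist x y := by
  have h : ∀ a b : ZMod 2, (a ≠ b + 1) ↔ ¬ (a ≠ b) := by decide
  have := Finset.card_filter_add_card_filter_not (s := (Finset.univ : Finset ι))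
    (fun i => x i ≠ y i)
  simp only [hammingDist, Pi.add_apply, Pi.one_apply, h]
  rw [Finset.card_univ] at this
  omega

theorem add_self_zmod_two {ι : Type*} (x : ι → ZMod 2) : x + x = 0 := by
  funext i; exact CharTwo.add_self_eq_zero _

theorem hammingDist_add_left_swap {ι : Type*} [Fintype ι] (x y z : ι → ZMod 2) :
    hammingDist x (y + z) = hammingDist (x + z) y := by
  rw [← hammingDist_add_right x (y + z) z, add_assoc, add_self_zmod_two, add_zero]

section

variable {n : ℕ} {k : ℕ} (τ : List (Fin n))

theorem min_le_hammingDist_partialSum_appendNew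
    (hτ : ∀ a b, a ≤ b → b ≤ τ.length →
      min (b - a) k ≤ hammingDist (partialSum τ a) (partialSum τ b))
    {a b : ℕ} (hab : a ≤ b) (hb : b ≤ τ.length + k) :
    min (b - a) k ≤
      hammingDist (partialSum (appendNew k τ) a) (partialSum (appendNew k τ) b) := by
  rw [partialSum_appendNew, partialSum_appendNew, hammingDist_append,
    hammingDist_initialOnes (by omega) (by omega)]
  have h := hτ (min a τ.length) (min b τ.length) (by omega) (by omega)
  have hm : ∀ c, partialSum τ (min c τ.length) = partialSum τ c := by
    intro c
    rcases le_total c τ.length with hc | hc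
    · rw [min_eq_left hc]
    · rw [min_eq_right hc, partialSum_of_length_le τ hc]
  rw [hm, hm] at h
  omega

/-- Vertices in opposite halves: translating by the full sum of one half complements the `k` new
coordinates. While `b` is within `τ` they alone differ in `k` places. Once `b` is past `τ`, its old
part cancels against the translation, and the distance of the old part of `a` from the start makes
up for new coordinates that have been lost. -/
theorem min_le_hammingDist_partialSum_appendNew_add
    (hτ : ∀ a b, a ≤ b → b ≤ τ.length →
      min (b - a) k ≤ hammingDist (partialSum τ a) (partialSum τ b))
    {a b : ℕ} (hab : a ≤ b) (hb : b ≤ τ.length + k) :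
    min (τ.length + k - (b - a)) k ≤
      hammingDist (partialSum (appendNew k τ) a)
        (partialSum (appendNew k τ) b + partialSum (appendNew k τ) (τ.length + k)) := by
  have h1 : initialOnes k (τ.length + k - τ.length) = 1 := by
    funext q; simp [initialOnes]
  rw [partialSum_appendNew, partialSum_appendNew, partialSum_appendNew, append_add_append,
    hammingDist_append, h1, hammingDist_add_one_right,
    hammingDist_initialOnes (by omega) (by omega), Fintype.card_fin,
    partialSum_of_length_le τ (show τ.length ≤ τ.length + k by omega)]
  rcases le_total b τ.length with hbN | hbN
  · omega
  · rw [partialSum_of_length_le τ hbN, add_self_zmod_two]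
    rcases le_total a τ.length with haN | haN
    · have h := hτ 0 a (by omega) haN
      rw [partialSum_zero, hammingDist_comm] at h
      omega
    · have h := hτ 0 τ.length (by omega) le_rfl
      rw [partialSum_zero, hammingDist_comm] at h
      rw [partialSum_of_length_le τ haN]
      omega

theorem exists_isCircuitCode_appendNew (hk : 1 ≤ k) (hN : 1 ≤ τ.length)
    (hτ : ∀ a b, a ≤ b → b ≤ τ.length →
      min (b - a) k ≤ hammingDist (partialSum τ a) (partialSum τ b)) :
    ∃ C : (hypercube (n + k)).Walk 0 0, IsCircuitCode k C ∧
      IsTransitionSeq C (appendNew k τ ++ appendNew k τ) ∧ C.length = 2 * (τ.length + k) := by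
  have hL : (appendNew k τ).length = τ.length + k := by simp [appendNew]
  set n' := τ.length + k with hn'
  have hend : partialSum (appendNew k τ ++ appendNew k τ) (2 * n') = 0 := by
    rw [partialSum_append, hL, partialSum_of_length_le _ (by omega), hL,
      show 2 * n' - n' = n' by omega, add_self_zmod_two]
  obtain ⟨v, C, hC⟩ := exists_isTransitionSeq (appendNew k τ ++ appendNew k τ) 0
  obtain ⟨hlen, hv⟩ := hC.getVert_eq
  rw [List.length_append, hL, ← two_mul] at hlen
  have h0 : v = 0 := by
    rw [← C.getVert_length, hv _ le_rfl, ← hlen, hend, add_zero]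
  subst h0
  refine ⟨C, isCircuitCode_of_getVert hk C (by omega) fun a b hab hb => ?_, hC, hlen.symm⟩
  rw [hv a (by omega), hv b (by omega), zero_add, zero_add, partialSum_append, partialSum_append,
    hL, ← hlen]
  rw [← hlen] at hb
  have hz : ∀ c, c ≤ n' → partialSum (appendNew k τ) (c - n') = 0 := by
    intro c hc
    rw [Nat.sub_eq_zero_of_le hc, partialSum_zero]
  have hs : ∀ c, n' ≤ c → partialSum (appendNew k τ) c = partialSum (appendNew k τ) n' := by
    intro c hc
    rw [partialSum_of_length_le _ (by omega), hL]
  rcases le_total b n' with hbn | hbn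
  · rw [hz a (by omega), hz b hbn, add_zero, add_zero]
    have := min_le_hammingDist_partialSum_appendNew τ hτ hab hbn
    omega
  · rcases le_total n' a with han | han
    · rw [hs a han, hs b hbn, hammingDist_add_left]
      have := min_le_hammingDist_partialSum_appendNew τ hτ
        (show a - n' ≤ b - n' by omega) (by omega)
      omega
    · rw [hz a han, hs b hbn, add_zero, add_comm (partialSum (appendNew k τ) n')]
      -- The estimate needs ordered indices; in the other order the translation is moved to the
      -- other vertex.
      rcases le_total a (b - n') with h | h
      · have := min_le_hammingDist_partialSum_appendNew_add τ hτ h (by omega)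
        rw [← hn'] at this
        omega
      · rw [hammingDist_add_left_swap, hammingDist_comm]
        have := min_le_hammingDist_partialSum_appendNew_add τ hτ h (by omega)
        rw [← hn'] at this
        omega

end

theorem IsDifferencePreserving.exists_isCircuitCode {n k : ℕ} (hk : 1 ≤ k) {u v : Fin n → ZMod 2}
    {P : (hypercube n).Walk u v} {τ : List (Fin n)} (hP : IsDifferencePreserving k P)
    (hN : 1 ≤ P.length) (hτ : IsTransitionSeq P τ) :
    ∃ C : (hypercube (n + k)).Walk 0 0, IsCircuitCode k C ∧
      IsTransitionSeq C (appendNew k τ ++ appendNew k τ) ∧ C.length = 2 * (P.length + k) := by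
  obtain ⟨hl, hv⟩ := hτ.getVert_eq
  rw [← hl] at hN ⊢
  refine exists_isCircuitCode_appendNew τ hk hN fun a b hab hb => ?_
  rw [hl] at hb
  have := hP.min_le_hammingDist hab hb
  rwa [hv a (by omega), hv b hb, hammingDist_add_left] at this

theorem exists_transitionSeq {u v : Fin d → ZMod 2} (w : (hypercube d).Walk u v) :
    ∃ τ, IsTransitionSeq w τ := by
  induction w with
  | nil => exact ⟨[], by simp [IsTransitionSeq]⟩
  | cons h p ih =>
    obtain ⟨τ, hτ⟩ := ih
    obtain ⟨t, ht⟩ := exists_add_single_of_hammingDist_eq_one h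
    refine ⟨t :: τ, ?_⟩
    rw [IsTransitionSeq, Walk.darts_cons, List.forall₂_cons]
    exact ⟨(differ_only_iff _ _ t).2 ht, hτ⟩

/-! ### Bounds for `K`, and the union bound for the columns -/

theorem le_K {d k : ℕ} {u : Fin d → ZMod 2} {C : (hypercube d).Walk u u}
    (hC : IsCircuitCode k C) : C.length ≤ K d k :=
  le_csSup (bddAbove_circuitLengths d k) ⟨u, C, hC, rfl⟩

theorem K_le (d k : ℕ) : K d k ≤ 2 ^ d := by
  refine csSup_le' ?_
  rintro n ⟨u, C, hC, rfl⟩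
  have h := hC.1.support_nodup.length_le_card
  simpa using h

theorem card_filter_card_le_le (n e : ℕ) (hn : 1 ≤ n) :
    ((Finset.univ : Finset (Finset (Fin n))).filter fun S => S.card ≤ e).card ≤
      (e + 1) * n ^ e := by
  have hsub : ((Finset.univ : Finset (Finset (Fin n))).filter fun S => S.card ≤ e) ⊆
      (Finset.range (e + 1)).biUnion fun j => Finset.powersetCard j Finset.univ := by
    intro S hS
    simp only [Finset.mem_filter, Finset.mem_univ, true_and] at hS
    simp only [Finset.mem_biUnion, Finset.mem_range, Finset.mem_powersetCard]
    exact ⟨S.card, by omega, Finset.subset_univ _, rfl⟩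
  refine (Finset.card_le_card hsub).trans (Finset.card_biUnion_le.trans ?_)
  rw [← smul_eq_mul]
  refine (Finset.sum_le_card_nsmul _ _ (n ^ e) fun j hj => ?_).trans (by simp)
  rw [Finset.card_powersetCard, Finset.card_univ, Fintype.card_fin]
  exact (Nat.choose_le_pow n j).trans
    (Nat.pow_le_pow_right hn (Nat.lt_succ_iff.1 (Finset.mem_range.1 hj)))

theorem card_filter_hammingNorm_lt_le (n k : ℕ) (hn : 1 ≤ n) (hk : 1 ≤ k) :
    ((Finset.univ : Finset (Fin n → ZMod 2)).filter fun z => hammingNorm z < k).card ≤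
      k * n ^ (k - 1) := by
  have h := card_filter_card_le_le n (k - 1) hn
  rw [Nat.sub_add_cancel hk] at h
  refine le_trans (Finset.card_le_card_of_injOn
    (fun z => Finset.univ.filter fun i => z i ≠ 0) ?_ ?_) h
  · intro z hz
    simp only [Finset.coe_filter, Finset.mem_univ, true_and, Set.mem_ofPred_eq] at hz ⊢
    rw [hammingNorm] at hz
    omega
  · intro z _ z' _ he
    funext i
    have h1 : (z i ≠ 0) ↔ (z' i ≠ 0) := by simpa using Finset.ext_iff.1 he i
    have h2 : ∀ a b : ZMod 2, ((a ≠ 0) ↔ (b ≠ 0)) → a = b := by decide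
    exact h2 _ _ h1

/-- If `F h` does not depend on the column `h T`, then `h T + F h` is equidistributed. -/
theorem card_filter_mul_le {κ V : Type*} [Fintype κ] [DecidableEq κ] [Fintype V]
    [AddGroup V] (B : V → Prop) [DecidablePred B] (T : κ) (F : (κ → V) → V)
    (hF : ∀ h v, F (Function.update h T v) = F h) :
    ((Finset.univ : Finset (κ → V)).filter fun h => B (h T + F h)).card * Fintype.card V ≤
      ((Finset.univ : Finset V).filter B).card * Fintype.card (κ → V) := by
  classical
  rw [← Finset.card_univ, ← Finset.card_univ, ← Finset.card_product, ← Finset.card_product]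
  -- The map replaces column `T` by `v` and records `h T + F h`. Since `F` ignores column `T`, both
  -- `F h` and the old `h T` can be recovered.
  refine Finset.card_le_card_of_injOn
    (fun q => (q.1 T + F q.1, Function.update q.1 T q.2)) ?_ ?_
  · rintro ⟨h, v⟩ hq
    simpa using hq
  · rintro ⟨h, v⟩ - ⟨h', v'⟩ - he
    simp only [Prod.mk.injEq] at he
    obtain ⟨h1, h2⟩ := he
    have hv : v = v' := by simpa using congrFun h2 T
    have hFF : F h = F h' := by rw [← hF h v, h2, hF]
    have hT : h T = h' T := by rw [hFF] at h1; exact add_right_cancel h1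
    have hh : h = h' := by
      have := congrArg (fun f => Function.update f T (h T)) h2
      simp only [Function.update_idem] at this
      rwa [Function.update_eq_self, hT, Function.update_eq_self] at this
    rw [hh, hv]

/-- Union bound over `s`: each event has at most the density of `B` in `V`, by equidistribution of
`h (T e) + F e h`. -/
theorem exists_forall_not_of_card_mul_lt {κ V E : Type*} [Fintype κ] [DecidableEq κ] [Fintype V]
    [AddGroup V] (B : V → Prop) [DecidablePred B] (s : Finset E) (T : E → κ)
    (F : E → (κ → V) → V)
    (hF : ∀ e ∈ s, ∀ h v, F e (Function.update h (T e) v) = F e h)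
    (hcard : s.card * ((Finset.univ : Finset V).filter B).card < Fintype.card V) :
    ∃ h : κ → V, ∀ e ∈ s, ¬ B (h (T e) + F e h) := by
  classical
  by_contra! hcon
  have hsub : (Finset.univ : Finset (κ → V)) ⊆
      s.biUnion fun e => Finset.univ.filter fun h => B (h (T e) + F e h) := by
    intro h _
    obtain ⟨e, he, hb⟩ := hcon h
    simp only [Finset.mem_biUnion, Finset.mem_filter, Finset.mem_univ, true_and]
    exact ⟨e, he, hb⟩
  have h1 := (Finset.card_le_card hsub).trans Finset.card_biUnion_le
  have h2 := Nat.mul_le_mul_right (Fintype.card V) h1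
  rw [Finset.sum_mul] at h2
  have h3 := h2.trans (Finset.sum_le_card_nsmul _ _ _ fun e he =>
    card_filter_mul_le B (T e) (F e) (hF e he))
  rw [Finset.card_univ, smul_eq_mul, ← mul_assoc, mul_comm] at h3
  have hpos : 0 < Fintype.card (κ → V) := Fintype.card_pos
  exact absurd (Nat.le_of_mul_le_mul_right h3 hpos) (by omega)

/-- The vector `v` with the entries before position `p` replaced by zero. -/
def dropBefore {r : ℕ} (p : ℕ) (v : Fin r → ZMod 2) : Fin r → ZMod 2 :=
  fun q => if p ≤ (q : ℕ) then v q else 0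

/-- Any `h T` stays far from the short sums of other columns and of tails of two other columns. -/
def ColumnsSpread {m M : ℕ} (k : ℕ) (h : Fin m → Fin M → ZMod 2) : Prop :=
  ∀ (T : Fin m) (S : Finset (Fin m)) (t t' : Fin m) (p p' : ℕ), T ∉ S → S.card + 2 ≤ k →
    t ≠ T → t' ≠ T →
    k ≤ hammingNorm (h T + (∑ s ∈ S, h s + dropBefore p (h t) + dropBefore p' (h t')))

theorem dropBefore_min {r : ℕ} (p : ℕ) (v : Fin r → ZMod 2) :
    dropBefore (min p r) v = dropBefore p v := by
  funext q
  have : min p r ≤ (q : ℕ) ↔ p ≤ (q : ℕ) := by omega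
  simp only [dropBefore, this]

theorem exists_columnsSpread {k m M : ℕ} (hm : 1 ≤ m) (hM : 1 ≤ M) (hk : 1 ≤ k)
    (hcard : k ^ 2 * (m ^ (k + 1) * ((M + 1) ^ 2 * M ^ (k - 1))) < 2 ^ M) :
    ∃ h : Fin m → Fin M → ZMod 2, ColumnsSpread k h := by
  -- For `k = 1` the condition `S.card + 2 ≤ k` is never met.
  rcases Nat.lt_or_ge k 2 with hk2 | hk2
  · exact ⟨0, fun _ _ _ _ _ _ _ h => by omega⟩
  let Sm := (Finset.univ : Finset (Finset (Fin m))).filter fun S => S.card ≤ k - 2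
  let s₀ : Finset (Fin m × Finset (Fin m) × Fin m × Fin m × Fin (M + 1) × Fin (M + 1)) :=
    Finset.univ ×ˢ Sm ×ˢ Finset.univ
  let s := s₀.filter fun e => e.1 ∉ e.2.1 ∧ e.2.2.1 ≠ e.1 ∧ e.2.2.2.1 ≠ e.1
  have hs : s.card ≤ m * (k * m ^ (k - 2)) * (m ^ 2 * (M + 1) ^ 2) := by
    refine (Finset.card_filter_le _ _).trans ?_
    have h1 : Sm.card ≤ k * m ^ (k - 2) :=
      (card_filter_card_le_le m (k - 2) hm).trans (Nat.mul_le_mul_right _ (by omega))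
    simp only [s₀, Finset.card_product, Finset.card_univ, Fintype.card_prod, Fintype.card_fin]
    calc m * (Sm.card * (m * (m * ((M + 1) * (M + 1)))))
        ≤ m * ((k * m ^ (k - 2)) * (m * (m * ((M + 1) * (M + 1))))) := by gcongr
      _ = _ := by ring
  have key := exists_forall_not_of_card_mul_lt (κ := Fin m) (V := Fin M → ZMod 2)
    (fun z => hammingNorm z < k) s (fun e => e.1)
    (fun e h => ∑ j ∈ e.2.1, h j + dropBefore e.2.2.2.2.1 (h e.2.2.1) +
      dropBefore e.2.2.2.2.2 (h e.2.2.2.1))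
  have hF : ∀ e ∈ s, ∀ (h : Fin m → Fin M → ZMod 2) v,
      ∑ j ∈ e.2.1, Function.update h e.1 v j +
        dropBefore e.2.2.2.2.1 (Function.update h e.1 v e.2.2.1) +
        dropBefore e.2.2.2.2.2 (Function.update h e.1 v e.2.2.2.1) =
      ∑ j ∈ e.2.1, h j + dropBefore e.2.2.2.2.1 (h e.2.2.1) +
        dropBefore e.2.2.2.2.2 (h e.2.2.2.1) := by
    rintro ⟨T, S, t, t', p, p'⟩ he h v
    simp only [s, Finset.mem_filter] at he
    obtain ⟨-, hTS, ht, ht'⟩ := he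
    simp only [Function.update_of_ne ht, Function.update_of_ne ht']
    congr 2
    exact Finset.sum_congr rfl fun j hj =>
      Function.update_of_ne (show j ≠ T from fun hjT => hTS (hjT ▸ hj)) v h
  obtain ⟨h, hh⟩ := key hF (by
    have hV : Fintype.card (Fin M → ZMod 2) = 2 ^ M := by simp [ZMod.card]
    rw [hV]
    refine lt_of_le_of_lt ?_ hcard
    refine (Nat.mul_le_mul hs (card_filter_hammingNorm_lt_le M k hM hk)).trans (le_of_eq ?_)
    obtain ⟨l, rfl⟩ := Nat.exists_eq_add_of_le hk2
    rw [show 2 + l - 2 = l by omega]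
    ring)
  refine ⟨h, fun T S t t' p p' hTS hS ht ht' => ?_⟩
  -- Thresholds beyond `M` all give the zero tail, so `M + 1` values cover every `p`.
  have := hh (T, S, t, t', ⟨min p M, by omega⟩, ⟨min p' M, by omega⟩) (by
    simp only [s, s₀, Sm, Finset.mem_filter, Finset.mem_product, Finset.mem_univ, true_and,
      and_true]
    exact ⟨by omega, hTS, ht, ht'⟩)
  simpa [dropBefore_min] using this

/-! ### Gray codes and coordinate comparisons -/

theorem hammingDist_cons {n : ℕ} (a b : ZMod 2) (x y : Fin n → ZMod 2) :
    hammingDist (Fin.cons a x : Fin (n + 1) → ZMod 2) (Fin.cons b y) =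
      (if a ≠ b then 1 else 0) + hammingDist x y := by
  simp only [hammingDist_eq_sum, Fin.sum_univ_succ, Fin.cons_zero, Fin.cons_succ]

theorem exists_grayCode (m : ℕ) : ∃ x : ℕ → Fin m → ZMod 2,
    (∀ j, j + 1 < 2 ^ m → hammingDist (x j) (x (j + 1)) = 1) ∧
      ∀ i j, i < 2 ^ m → j < 2 ^ m → x i = x j → i = j := by
  induction m with
  | zero =>
    refine ⟨fun _ => 0, fun j hj => ?_, fun i j hi hj _ => ?_⟩
    · simp at hj
    · simp at hi hj
      omega
  | succ m ih =>
    obtain ⟨x, hx, hinj⟩ := ih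
    -- Reflected code: the second half runs backwards, so only the new bit changes in the middle.
    refine ⟨fun j => if j < 2 ^ m then Fin.cons 0 (x j) else Fin.cons 1 (x (2 ^ (m + 1) - 1 - j)),
      fun j hj => ?_, fun i j hi hj hij => ?_⟩
    · rw [pow_succ] at hj ⊢
      rcases lt_trichotomy (j + 1) (2 ^ m) with h | h | h
      · simp only [show j < 2 ^ m by omega, h, if_true, hammingDist_cons]
        simp [hx j h]
      · simp only [show j < 2 ^ m by omega, show ¬ (j + 1 < 2 ^ m) by omega, if_true, if_false,
          hammingDist_cons]
        rw [show 2 ^ m * 2 - 1 - (j + 1) = j by omega]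
        simp
      · simp only [show ¬ (j < 2 ^ m) by omega, show ¬ (j + 1 < 2 ^ m) by omega, if_false,
          hammingDist_cons]
        have := hx (2 ^ m * 2 - 1 - (j + 1)) (by omega)
        rw [show 2 ^ m * 2 - 1 - (j + 1) + 1 = 2 ^ m * 2 - 1 - j by omega] at this
        rw [hammingDist_comm (x (2 ^ m * 2 - 1 - j)), this]
        simp
    · rw [pow_succ] at hi hj
      simp only [pow_succ] at hij
      split_ifs at hij with h1 h2 h2
      · exact hinj i j h1 h2 (Fin.cons_right_injective _ hij)
      · simpa using congrFun hij 0
      · simpa using congrFun hij 0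
      · have := hinj _ _ (by omega) (by omega) (Fin.cons_right_injective _ hij)
        omega

theorem hammingDist_eq_hammingNorm_add {ι : Type*} [Fintype ι] (x y : ι → ZMod 2) :
    hammingDist x y = hammingNorm (x + y) := by
  rw [← hammingDist_zero_right, ← hammingDist_add_right x y y, add_self_zmod_two]

theorem hammingNorm_comp_injective_le {ι κ : Type*} [Fintype ι] [Fintype κ] (e : ι → κ)
    (he : Function.Injective e) (x : κ → ZMod 2) : hammingNorm (x ∘ e) ≤ hammingNorm x := by
  rw [← hammingDist_zero_right, ← hammingDist_zero_right]
  exact hammingDist_comp_injective_le e he x 0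

theorem card_le_hammingNorm_of_forall_eq_one {ι κ : Type*} [Fintype ι] [Fintype κ] (e : ι → κ)
    (he : Function.Injective e) (x : κ → ZMod 2) (hx : ∀ i, x (e i) = 1) :
    Fintype.card ι ≤ hammingNorm x := by
  refine le_trans (le_of_eq ?_) (hammingNorm_comp_injective_le e he x)
  simp [hammingNorm, hx]

theorem hammingDist_eq_add_of_forall {ι : Type*} [Fintype ι] {u v w : ι → ZMod 2}
    (h : ∀ c, u c = v c ∨ v c = w c) :
    hammingDist u w = hammingDist u v + hammingDist v w := by
  simp only [hammingDist_eq_sum, ← Finset.sum_add_distrib]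
  refine Finset.sum_congr rfl fun c _ => ?_
  rcases h c with h | h <;> simp [h]

theorem eq_add_sum_single {m : ℕ} (x y : Fin m → ZMod 2) :
    y = x + ∑ i ∈ Finset.univ.filter (fun i => x i ≠ y i), (Pi.single i 1 : Fin m → ZMod 2) := by
  funext j
  rw [Pi.add_apply, Finset.sum_apply, Finset.sum_filter]
  have : ∀ i, (if x i ≠ y i then (Pi.single i 1 : Fin m → ZMod 2) j else 0) =
      if i = j then (if x j ≠ y j then 1 else 0) else 0 := by
    intro i
    by_cases hij : i = j
    · subst hij; simp
    · simp [hij, Ne.symm hij]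
  simp only [this, Finset.sum_ite_eq', Finset.mem_univ, if_true]
  generalize x j = a
  generalize y j = b
  revert a b
  decide

/-! ### The path of messages with parity bits -/

section

variable {k m M : ℕ}

/-- The column `h` framed by `k` ones on either side. -/
def framed (k : ℕ) (h : Fin M → ZMod 2) : Fin (k + M + k) → ZMod 2 :=
  Fin.append (Fin.append 1 h) 1

/-- The position in a framed column of the `q`-th inner entry. -/
def inner (k : ℕ) (q : Fin M) : Fin (k + M + k) := Fin.castAdd k (Fin.natAdd k q)

theorem inner_injective : Function.Injective (inner (M := M) k) :=
  (Fin.castAdd_injective _ _).comp (Fin.natAdd_injective _ _)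

theorem framed_inner (h : Fin M → ZMod 2) (q : Fin M) : framed k h (inner k q) = h q := by
  simp [framed, inner]

theorem dropBefore_inner (p : ℕ) (v : Fin (k + M + k) → ZMod 2) (q : Fin M) :
    dropBefore p v (inner k q) = dropBefore (p - k) (v ∘ inner k) q := by
  simp only [dropBefore, inner, Fin.val_castAdd, Fin.val_natAdd, Function.comp]
  congr 1
  simp only [eq_iff_iff]
  omega

theorem dropBefore_zero {r : ℕ} (v : Fin r → ZMod 2) : dropBefore 0 v = v := by
  funext q; simp [dropBefore]

theorem dropBefore_of_length_le {r p : ℕ} (hp : r ≤ p) (v : Fin r → ZMod 2) :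
    dropBefore p v = 0 := by
  funext q
  simp only [dropBefore, Pi.zero_apply, ite_eq_right_iff]
  omega

variable (h : Fin m → Fin M → ZMod 2) (x : ℕ → Fin m → ZMod 2) (t : ℕ → Fin m)

/-- The parity bits of `x` with respect to the framed columns. -/
def parity (k : ℕ) : (Fin m → ZMod 2) →ₗ[ZMod 2] (Fin (k + M + k) → ZMod 2) :=
  Fintype.linearCombination (ZMod 2) fun i => framed k (h i)

theorem parity_add_single (y : Fin m → ZMod 2) (i : Fin m) :
    parity h k (y + Pi.single i 1) = parity h k y + framed k (h i) := by
  rw [map_add, parity, Fintype.linearCombination_apply_single, one_smul]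

theorem parity_eq_add_sum (y z : Fin m → ZMod 2) :
    parity h k z = parity h k y +
      ∑ i ∈ Finset.univ.filter (fun i => y i ≠ z i), framed k (h i) := by
  conv_lhs => rw [eq_add_sum_single y z]
  rw [map_add, map_sum]
  congr 1
  refine Finset.sum_congr rfl fun i _ => ?_
  rw [parity, Fintype.linearCombination_apply_single, one_smul]

/-- The parity bits reached after the message `x (j + 1)`, when those before position `p` have
already been updated to the new message. -/
def parityAt (k j p : ℕ) : Fin (k + M + k) → ZMod 2 :=
  parity h k (x (j + 1)) + dropBefore p (framed k (h (t j)))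

/-- The vertex consisting of a message and of partially updated parity bits. -/
def vertexAt (k j p : ℕ) : Fin (m + (k + M + k)) → ZMod 2 :=
  Fin.append (x (j + 1)) (parityAt h x t k j p)

variable {h x t}

theorem hammingDist_vertexAt (i j p q : ℕ) :
    hammingDist (vertexAt h x t k i p) (vertexAt h x t k j q) =
      hammingDist (x (i + 1)) (x (j + 1)) +
        hammingDist (parityAt h x t k i p) (parityAt h x t k j q) :=
  hammingDist_append _ _ _ _

/-- Otherwise the messages differ only within `{t i, t j}`. Cancelling Gray steps then makes one of
`x i`, `x (i + 1)` equal to one of `x j`, `x (j + 1)`, against injectivity. The gap of two excludes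
`x (i + 1) = x j`. -/
theorem exists_differ_of_far
    (hx : ∀ j, j + 1 < 2 ^ m → x (j + 1) = x j + Pi.single (t j) 1)
    (hinj : ∀ i j, i < 2 ^ m → j < 2 ^ m → x i = x j → i = j)
    {i j : ℕ} (hij : i + 2 ≤ j) (hj : j + 1 < 2 ^ m) :
    ∃ T, x (i + 1) T ≠ x (j + 1) T ∧ t i ≠ T ∧ t j ≠ T := by
  by_contra! hcon
  set D := Finset.univ.filter (fun T => x (i + 1) T ≠ x (j + 1) T) with hD
  have hsub : D ⊆ {t i, t j} := by
    intro T hT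
    simp only [hD, Finset.mem_filter, Finset.mem_univ, true_and] at hT
    simp only [Finset.mem_insert, Finset.mem_singleton]
    by_cases h1 : t i = T
    · exact Or.inl h1.symm
    · exact Or.inr (hcon T hT h1).symm
  have heq := eq_add_sum_single (x (i + 1)) (x (j + 1))
  rw [← hD] at heq
  have hxi := hx i (by omega)
  have hxj := hx j hj
  have two : ∀ z : Fin m → ZMod 2, ∀ s, z + Pi.single s 1 + Pi.single s 1 = z := by
    intro z s
    rw [add_assoc, add_self_zmod_two, add_zero]
  by_cases htt : t i = t j
  · rw [htt, Finset.pair_eq_singleton, Finset.subset_singleton_iff] at hsub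
    rcases hsub with h0 | h0
    · rw [h0, Finset.sum_empty, add_zero] at heq
      have := hinj _ _ hj (by omega) heq
      omega
    · rw [h0, Finset.sum_singleton, hxi, ← htt, two] at heq
      have := hinj _ _ hj (by omega) heq
      omega
  · have hcases : D = ∅ ∨ D = {t i} ∨ D = {t j} ∨ D = {t i, t j} := by
      rw [← Finset.mem_powerset] at hsub
      rw [Finset.powerset_insert] at hsub
      simp only [Finset.mem_union, Finset.mem_image, Finset.mem_powerset,
        Finset.subset_singleton_iff] at hsub
      rcases hsub with (h0 | h0) | ⟨a, rfl | rfl, h0⟩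
      · exact Or.inl h0
      · exact Or.inr (Or.inr (Or.inl h0))
      · exact Or.inr (Or.inl h0.symm)
      · exact Or.inr (Or.inr (Or.inr h0.symm))
    rcases hcases with h0 | h0 | h0 | h0
    · rw [h0, Finset.sum_empty, add_zero] at heq
      have := hinj _ _ hj (by omega) heq
      omega
    · rw [h0, Finset.sum_singleton, hxi, two] at heq
      have := hinj _ _ hj (by omega) heq
      omega
    · rw [h0, Finset.sum_singleton, hxj] at heq
      have := hinj _ _ (by omega) (by omega) (add_right_cancel heq)
      omega
    · rw [h0, Finset.sum_pair htt, hxi, hxj, ← add_assoc, two] at heq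
      have := hinj _ _ (by omega) (by omega) (add_right_cancel heq)
      omega

theorem le_hammingDist_vertexAt_of_far (hh : ColumnsSpread k h)
    (hx : ∀ j, j + 1 < 2 ^ m → x (j + 1) = x j + Pi.single (t j) 1)
    (hinj : ∀ i j, i < 2 ^ m → j < 2 ^ m → x i = x j → i = j)
    {i j : ℕ} (hij : i + 2 ≤ j) (hj : j + 1 < 2 ^ m) (p q : ℕ) :
    k ≤ hammingDist (vertexAt h x t k i p) (vertexAt h x t k j q) := by
  rw [hammingDist_vertexAt]
  obtain ⟨T, hT, hti, htj⟩ := exists_differ_of_far hx hinj hij hj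
  set D := Finset.univ.filter (fun T => x (i + 1) T ≠ x (j + 1) T) with hD
  have hTD : T ∈ D := by simpa [hD] using hT
  have hcard : hammingDist (x (i + 1)) (x (j + 1)) = D.card := rfl
  -- With `k` or more differing message bits the parity is not needed; with fewer, `D.erase T` is
  -- small enough for `ColumnsSpread`.
  rcases Nat.lt_or_ge D.card k with hlt | hge
  · have hS := hh T (D.erase T) (t i) (t j) (p - k) (q - k) (Finset.notMem_erase _ _)
      (by
        rw [Finset.card_erase_of_mem hTD]
        have : 0 < D.card := Finset.card_pos.2 ⟨T, hTD⟩
        omega) hti htj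
    refine hS.trans (le_trans (le_of_eq ?_) (le_add_left (le_trans
      (hammingNorm_comp_injective_le (inner k) inner_injective _)
      (hammingDist_eq_hammingNorm_add _ _).ge)))
    congr 1
    funext c
    have hpar : parity h k (x (i + 1)) (inner k c) + parity h k (x (j + 1)) (inner k c) =
        h T c + ∑ s ∈ D.erase T, h s c := by
      rw [parity_eq_add_sum h (x (i + 1)) (x (j + 1)), ← hD, Pi.add_apply, ← add_assoc,
        CharTwo.add_self_eq_zero, zero_add, Finset.sum_apply, ← Finset.add_sum_erase _ _ hTD]
      simp only [framed_inner]
    have hfr : ∀ s, framed k (h s) ∘ inner k = h s := fun s => funext fun c => framed_inner _ c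
    simp only [Function.comp, parityAt, Pi.add_apply, Finset.sum_apply, dropBefore_inner]
    rw [hfr, hfr, ← add_assoc, ← add_assoc, ← hpar]
    ring
  · omega

/-- The parities differ by the new column, the tail from `p` of the old one and the tail from `q` of
the new one. If `k ≤ p`, only the new column reaches the left frame, giving `k` ones. If `q ≤ k +
M`, all three reach the right frame whenever `p < q`, and `1 + 1 + 1 = 1`. Otherwise the inner bits
are the sum of the two full columns, which `ColumnsSpread` with `S = ∅` controls. -/
theorem le_hammingDist_vertexAt_of_lt (hh : ColumnsSpread k h)
    (hx : ∀ j, j + 1 < 2 ^ m → x (j + 1) = x j + Pi.single (t j) 1)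
    (hinj : ∀ i j, i < 2 ^ m → j < 2 ^ m → x i = x j → i = j)
    {j : ℕ} (hj : j + 2 < 2 ^ m) {p q : ℕ} (hpq : p < q) :
    k ≤ hammingDist (vertexAt h x t k j p) (vertexAt h x t k (j + 1) q) := by
  rw [hammingDist_vertexAt]
  have hx1 := hx (j + 1) (by omega)
  have hx0 := hx j (by omega)
  have hd : hammingDist (x (j + 1)) (x (j + 1 + 1)) = 1 := by
    rw [hx1, hammingDist_add_single]
  rcases Nat.lt_or_ge k 2 with hk2 | hk2
  · omega
  refine le_add_left ?_
  have htt : t (j + 1) ≠ t j := by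
    intro htt
    rw [hx0, htt, add_assoc (x j), add_self_zmod_two, add_zero] at hx1
    have := hinj _ _ hj (by omega) hx1
    omega
  have hval : ∀ c, (parityAt h x t k j p + parityAt h x t k (j + 1) q) c =
      framed k (h (t (j + 1))) c +
        (dropBefore p (framed k (h (t j))) c + dropBefore q (framed k (h (t (j + 1)))) c) := by
    intro c
    rw [parityAt, parityAt, hx1, parity_add_single]
    simp only [Pi.add_apply]
    have := CharTwo.add_self_eq_zero (parity h k (x (j + 1)) c)
    linear_combination this
  rw [hammingDist_eq_hammingNorm_add]
  rcases Nat.lt_or_ge p k with hpk | hpk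
  · rcases Nat.lt_or_ge (k + M) q with hqk | hqk
    · have hS := hh (t (j + 1)) ∅ (t j) (t j) 0 M (Finset.notMem_empty _) (by simpa using hk2)
        htt.symm htt.symm
      refine hS.trans (le_trans (le_of_eq ?_)
        (hammingNorm_comp_injective_le (inner k) inner_injective _))
      congr 1
      funext c
      have hfr : ∀ s, framed k (h s) ∘ inner k = h s := fun s => funext fun c => framed_inner _ c
      have hq : dropBefore (q - k) (h (t (j + 1))) c = 0 := by
        simp only [dropBefore, ite_eq_right_iff]
        omega
      rw [Function.comp, hval, dropBefore_inner, dropBefore_inner, hfr, hfr, hq, framed_inner,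
        Nat.sub_eq_zero_of_le hpk.le, dropBefore_of_length_le le_rfl, Finset.sum_empty, zero_add]
      rfl
    · have := card_le_hammingNorm_of_forall_eq_one (fun c : Fin k => Fin.natAdd (k + M) c)
        (Fin.natAdd_injective _ _) (parityAt h x t k j p + parityAt h x t k (j + 1) q) ?_
      · simpa using this
      · intro c
        rw [hval]
        have h1 : p ≤ k + M + (c : ℕ) := by omega
        have h2 : q ≤ k + M + (c : ℕ) := by omega
        simp only [dropBefore, framed, Fin.append_right, Fin.val_natAdd, h1, h2, if_true, Pi.one_apply]
        decide
  · have := card_le_hammingNorm_of_forall_eq_one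
      (fun c : Fin k => Fin.castAdd k (Fin.castAdd M c))
      ((Fin.castAdd_injective _ _).comp (Fin.castAdd_injective _ _))
      (parityAt h x t k j p + parityAt h x t k (j + 1) q) ?_
    · simpa using this
    · intro c
      rw [hval]
      have h1 : ¬ (p ≤ (c : ℕ)) := by omega
      have h2 : ¬ (q ≤ (c : ℕ)) := by omega
      simp [dropBefore, framed, h1, h2]

theorem hammingDist_vertexAt_succ_le (j p : ℕ) :
    hammingDist (vertexAt h x t k j p) (vertexAt h x t k j (p + 1)) ≤ 1 := by
  rw [hammingDist_vertexAt, hammingDist_self, zero_add, hammingDist, Finset.card_le_one]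
  have key : ∀ c : Fin (k + M + k), parityAt h x t k j p c ≠ parityAt h x t k j (p + 1) c →
      (c : ℕ) = p := by
    intro c hc
    by_contra hne
    apply hc
    have : p ≤ (c : ℕ) ↔ p + 1 ≤ (c : ℕ) := by omega
    simp only [parityAt, Pi.add_apply, dropBefore, this]
  intro a ha b hb
  simp only [Finset.mem_filter, Finset.mem_univ, true_and] at ha hb
  exact Fin.ext ((key a ha).trans (key b hb).symm)

/-- Only parity bit `q` can change in this step, so agreement there beforehand means that a change
creates a new difference. -/
theorem hammingDist_vertexAt_succ_eq_add {i j p q : ℕ}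
    (hc : ∀ c : Fin (k + M + k), (c : ℕ) = q →
      parityAt h x t k i p c = parityAt h x t k j q c) :
    hammingDist (vertexAt h x t k i p) (vertexAt h x t k j (q + 1)) =
      hammingDist (vertexAt h x t k i p) (vertexAt h x t k j q) +
        hammingDist (vertexAt h x t k j q) (vertexAt h x t k j (q + 1)) := by
  have := hammingDist_eq_add_of_forall (u := parityAt h x t k i p) (v := parityAt h x t k j q)
    (w := parityAt h x t k j (q + 1)) fun c => by
      by_cases hcq : (c : ℕ) = q
      · exact Or.inl (hc c hcq)
      · right
        have : q ≤ (c : ℕ) ↔ q + 1 ≤ (c : ℕ) := by omega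
        simp only [parityAt, Pi.add_apply, dropBefore, this]
  rw [hammingDist_vertexAt, hammingDist_vertexAt, hammingDist_vertexAt, this, hammingDist_self]
  ring

/-- A block starts with the parity at which the previous one ended, so passing between blocks
changes only the message. -/
theorem parityAt_succ_zero
    (hx : ∀ j, j + 1 < 2 ^ m → x (j + 1) = x j + Pi.single (t j) 1)
    {j : ℕ} (hj : j + 2 < 2 ^ m) :
    parityAt h x t k (j + 1) 0 = parityAt h x t k j (k + M + k) := by
  rw [parityAt, parityAt, hx (j + 1) (by omega), parity_add_single, dropBefore_zero,
    dropBefore_of_length_le le_rfl, add_assoc (parity h k (x (j + 1))), add_self_zmod_two]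

theorem exists_isDifferencePreserving_of_columnsSpread (hk : 1 ≤ k) (hm : 1 ≤ m)
    (hh : ColumnsSpread k h) :
    ∃ (u v : Fin (m + (k + M + k)) → ZMod 2) (P : (hypercube (m + (k + M + k))).Walk u v),
      IsDifferencePreserving k P ∧ 2 ^ m - 2 ≤ P.length := by
  obtain ⟨x, hx1, hinj⟩ := exists_grayCode m
  have ht : ∀ j, ∃ s, j + 1 < 2 ^ m → x (j + 1) = x j + Pi.single s 1 := by
    intro j
    by_cases hj : j + 1 < 2 ^ m
    · obtain ⟨s, hs⟩ := exists_add_single_of_hammingDist_eq_one (hx1 j hj)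
      exact ⟨s, fun _ => hs⟩
    · exact ⟨⟨0, hm⟩, fun h => absurd h hj⟩
  choose t hx using ht
  obtain ⟨R, hR⟩ : ∃ R, R = k + M + k := ⟨_, rfl⟩
  have hRpos : 0 < R + 1 := by omega
  -- Block `n` has message `x (n + 1)`, because it needs a preceding Gray step; the blocks are
  -- therefore `0, …, J`.
  set J := 2 ^ m - 2 with hJ
  have h2m : 2 ≤ 2 ^ m := by
    calc 2 = 2 ^ 1 := by norm_num
      _ ≤ 2 ^ m := Nat.pow_le_pow_right (by norm_num) hm
  let g : ℕ → Fin (m + (k + M + k)) → ZMod 2 := fun n =>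
    vertexAt h x t k (n / (R + 1)) (n % (R + 1))
  have hdiv : ∀ n p, p ≤ R → (n * (R + 1) + p) / (R + 1) = n ∧ (n * (R + 1) + p) % (R + 1) = p := by
    intro n p hp
    rw [Nat.div_mod_unique hRpos]
    exact ⟨by ring, by omega⟩
  have hg : ∀ n p, p ≤ R → g (n * (R + 1) + p) = vertexAt h x t k n p := by
    intro n p hp
    simp only [g, (hdiv n p hp).1, (hdiv n p hp).2]
  have hex : ∀ a, ∃ n p, p ≤ R ∧ a = n * (R + 1) + p := fun a =>
    ⟨a / (R + 1), a % (R + 1), Nat.lt_succ_iff.1 (Nat.mod_lt _ hRpos),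
      (Nat.div_add_mod' _ _).symm⟩
  have hbound : ∀ n p, n * (R + 1) + p < J * (R + 1) + (R + 1) → n ≤ J := by
    intro n p hn
    rw [← add_one_mul] at hn
    exact Nat.lt_succ_iff.1 (Nat.lt_of_mul_lt_mul_right ((Nat.le_add_right _ p).trans_lt hn))
  have hcarry : ∀ n, g (n * (R + 1) + R + 1) = vertexAt h x t k (n + 1) 0 := by
    intro n
    rw [← hg (n + 1) 0 (Nat.zero_le R)]
    congr 1
    ring
  have hzero : ∀ n, n + 2 < 2 ^ m →
      parityAt h x t k (n + 1) 0 = parityAt h x t k n R := by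
    rw [hR]
    exact fun n hn => parityAt_succ_zero hx hn
  have hjump : ∀ n, n + 2 < 2 ^ m →
      hammingDist (vertexAt h x t k n R) (vertexAt h x t k (n + 1) 0) = 1 := by
    intro n hn
    rw [hammingDist_vertexAt, hzero n hn, hammingDist_self, add_zero,
      hx1 (n + 1) hn]
  obtain ⟨u, v, P, hP, hlen⟩ := exists_isDifferencePreserving_of_lazy hk (J * (R + 1) + R) g
    (fun a ha => by
      obtain ⟨n, p, hp, rfl⟩ := hex a
      rcases hp.lt_or_eq with hp | hp
      · rw [hg n p hp.le, add_assoc (n * (R + 1)), hg n (p + 1) hp]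
        exact hammingDist_vertexAt_succ_le n p
      · rw [hp] at ha ⊢
        have : n + 1 ≤ J := hbound (n + 1) 0 (by rw [add_one_mul]; omega)
        rw [hg n R le_rfl, hcarry, hjump n (by omega)])
    (fun a b hab hb => by
      obtain ⟨i, p, hp, rfl⟩ := hex a
      obtain ⟨j, q, hq, rfl⟩ := hex b
      have hij : i ≤ j := by
        have := Nat.div_le_div_right (c := R + 1) hab
        rwa [(hdiv i p hp).1, (hdiv j q hq).1] at this
      have hj : j ≤ J := hbound j q (by omega)
      rw [hg i p hp, hg j q hq]
      rcases hq.lt_or_eq with hq | hq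
      · rw [add_assoc (j * (R + 1)), hg j (q + 1) hq]
        rcases hij.eq_or_lt with rfl | hij
        · right
          refine hammingDist_vertexAt_succ_eq_add fun c hc => ?_
          have h1 : p ≤ (c : ℕ) := by omega
          have h2 : q ≤ (c : ℕ) := by omega
          simp only [parityAt, Pi.add_apply, dropBefore, h1, h2]
        · rcases (Nat.succ_le_of_lt hij).eq_or_lt with rfl | hij
          · rcases Nat.lt_or_ge p (q + 1) with hpq | hpq
            · exact Or.inl (le_hammingDist_vertexAt_of_lt hh hx hinj (by omega) hpq)
            -- Bit `q` is already updated in block `i` and still pending in block `i + 1`, so both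
            -- vertices carry the parity of `x (i + 1)` there.
            · right
              refine hammingDist_vertexAt_succ_eq_add fun c hc => ?_
              have h1 : ¬ p ≤ (c : ℕ) := by omega
              have h2 : q ≤ (c : ℕ) := by omega
              simp only [parityAt, Pi.add_apply, dropBefore, h1, h2, if_true, if_false]
              rw [show i.succ + 1 = i + 1 + 1 from rfl, hx (i + 1) (by omega),
                parity_add_single, Pi.add_apply, add_assoc (parity h k (x (i + 1)) c),
                CharTwo.add_self_eq_zero]
          · exact Or.inl (le_hammingDist_vertexAt_of_far hh hx hinj hij (by omega) _ _)
      · rw [hq] at hb hab ⊢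
        have hj1 : j + 1 ≤ J := hbound (j + 1) 0 (by rw [add_one_mul]; omega)
        rw [hcarry]
        rcases hij.eq_or_lt with rfl | hij
        · right
          rw [hjump i (by omega), hammingDist_vertexAt, hammingDist_vertexAt,
            hzero i (by omega), hammingDist_self, hx1 (i + 1) (by omega)]
          ring
        · exact Or.inl (le_hammingDist_vertexAt_of_far hh hx hinj (by omega) (by omega) _ _))
  refine ⟨u, v, P, hP, ?_⟩
  have hinj' : Function.Injective fun n : ℕ => n * (R + 1) + R := by
    intro a b hab
    simpa using hab
  rw [hlen]
  -- Counting only the `J` message changes is enough for the length bound.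
  calc J = ((Finset.range J).image fun n => n * (R + 1) + R).card • 1 := by
        rw [Finset.card_image_of_injective _ hinj', Finset.card_range, smul_eq_mul, mul_one]
    _ ≤ ∑ a ∈ (Finset.range J).image fun n => n * (R + 1) + R,
          hammingDist (g a) (g (a + 1)) := by
        refine Finset.card_nsmul_le_sum _ _ _ fun a ha => ?_
        obtain ⟨n, hn, rfl⟩ := Finset.mem_image.1 ha
        rw [Finset.mem_range] at hn
        rw [hg n R le_rfl, hcarry, hjump n (by omega)]
    _ ≤ _ := by
        refine Finset.sum_le_sum_of_subset fun a ha => ?_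
        obtain ⟨n, hn, rfl⟩ := Finset.mem_image.1 ha
        rw [Finset.mem_range] at hn ⊢
        have := Nat.mul_lt_mul_of_pos_right hn hRpos
        omega

end

/-! ### Choice of parameters and the limit -/

theorem exists_isDifferencePreserving_length_one {d k : ℕ} (hk : 1 ≤ k) (hd : 1 ≤ d) :
    ∃ (u v : Fin d → ZMod 2) (P : (hypercube d).Walk u v),
      IsDifferencePreserving k P ∧ P.length = 1 := by
  have h1 := hammingDist_add_single (0 : Fin d → ZMod 2) ⟨0, hd⟩
  rw [zero_add] at h1
  refine exists_isDifferencePreserving_of_seq hk 1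
    (fun a => if a = 0 then 0 else Pi.single ⟨0, hd⟩ 1) (fun a ha => ?_) (fun a b hab hb => ?_)
  · obtain rfl : a = 0 := by omega
    simpa using h1
  · rcases hab.eq_or_lt with rfl | hab
    · simp
    · obtain rfl : a = 0 := by omega
      obtain rfl : b = 1 := by omega
      simp [h1]

theorem eventually_mul_pow_lt_two_pow (C e : ℕ) :
    ∀ᶠ i : ℕ in Filter.atTop, C * i ^ e < 2 ^ i := by
  have h := tendsto_pow_const_div_const_pow_of_one_lt e (show (1 : ℝ) < 2 by norm_num)
  have hC : (0 : ℝ) < 1 / (C + 1) := by positivity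
  filter_upwards [h.eventually (gt_mem_nhds hC)] with i hi
  rw [div_lt_div_iff₀ (by positivity) (by positivity), one_mul] at hi
  have h2 : ((C * i ^ e : ℕ) : ℝ) < ((2 ^ i : ℕ) : ℝ) := by
    push_cast
    have : (0 : ℝ) ≤ (i : ℝ) ^ e := by positivity
    nlinarith
  exact_mod_cast h2

theorem eventually_exists_long_isDifferencePreserving {k : ℕ} (hk : 1 ≤ k) :
    ∀ᶠ i : ℕ in Filter.atTop, ∃ m, m + (k + (k + 2) * i + k) = pathDim k i ∧
      ∃ (u v : Fin (pathDim k i) → ZMod 2) (P : (hypercube (pathDim k i)).Walk u v),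
        IsDifferencePreserving k P ∧ 2 ^ m ≤ 2 * P.length := by
  filter_upwards [eventually_mul_pow_lt_two_pow (k ^ 2 * (k + 3) ^ (k + 1)) (k + 1),
    Filter.eventually_ge_atTop 2] with i hi hi2
  have hki : (k + 2) * i = k * i + 2 * i := by ring
  -- The remaining dimension is `m = 2 ^ i + 2 * k - 4 - k * i`; this bound gives `m ≥ 2`, and `2 *
  -- k ≤ k * i` below gives `m ≤ 2 ^ i`.
  have hlow : k * i + 6 ≤ 2 ^ i := by
    have h1 : (k + 3) ^ 2 * i ≤ k ^ 2 * (k + 3) ^ (k + 1) * i ^ (k + 1) := by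
      calc (k + 3) ^ 2 * i = 1 * (k + 3) ^ 2 * i ^ 1 := by ring
        _ ≤ k ^ 2 * (k + 3) ^ (k + 1) * i ^ (k + 1) := by
          gcongr
          · exact Nat.one_le_pow _ _ hk
          · omega
          · omega
          · omega
          · omega
    nlinarith
  have hk2i : 2 * k ≤ k * i := by nlinarith
  obtain ⟨m, hm⟩ : ∃ m, m + (k + (k + 2) * i + k) = pathDim k i :=
    ⟨pathDim k i - (k + (k + 2) * i + k), by rw [pathDim]; omega⟩
  refine ⟨m, hm, ?_⟩
  have hm' : m + (k + (k + 2) * i + k) = 2 ^ i + 2 * i + 4 * k - 4 := hm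
  have hm2 : 2 ≤ m := by omega
  have hmle : m ≤ 2 ^ i := by omega
  obtain ⟨h, hh⟩ := exists_columnsSpread (k := k) (m := m) (M := (k + 2) * i) (by omega)
    (by omega) hk (by
      have h1 : ((k + 2) * i + 1) ^ 2 * ((k + 2) * i) ^ (k - 1) ≤ ((k + 3) * i) ^ (k + 1) := by
        have hle : (k + 2) * i + 1 ≤ (k + 3) * i := by nlinarith
        calc ((k + 2) * i + 1) ^ 2 * ((k + 2) * i) ^ (k - 1)
            ≤ ((k + 3) * i) ^ 2 * ((k + 3) * i) ^ (k - 1) := by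
              gcongr
              omega
          _ = ((k + 3) * i) ^ (k + 1) := by
              rw [← pow_add]
              congr 1
              omega
      calc k ^ 2 * (m ^ (k + 1) * (((k + 2) * i + 1) ^ 2 * ((k + 2) * i) ^ (k - 1)))
          ≤ k ^ 2 * ((2 ^ i) ^ (k + 1) * ((k + 3) * i) ^ (k + 1)) := by gcongr
        _ = (2 ^ i) ^ (k + 1) * (k ^ 2 * (k + 3) ^ (k + 1) * i ^ (k + 1)) := by
            rw [mul_pow]
            ring
        _ < (2 ^ i) ^ (k + 1) * 2 ^ i := by gcongr
        _ = 2 ^ ((k + 2) * i) := by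
            rw [← pow_succ, ← pow_mul]
            congr 1
            ring)
  have := exists_isDifferencePreserving_of_columnsSpread hk (by omega) hh
  rw [hm] at this
  obtain ⟨u, v, P, hP, hlen⟩ := this
  refine ⟨u, v, P, hP, ?_⟩
  have : 2 ^ 2 ≤ 2 ^ m := Nat.pow_le_pow_right (by norm_num) hm2
  omega

theorem exists_const_forall_isDifferencePreserving {k : ℕ} (hk : 1 ≤ k) :
    ∃ c : ℝ, ∀ i : ℕ, 1 ≤ i →
      ∃ (u v : Fin (pathDim k i) → ZMod 2) (P : (hypercube (pathDim k i)).Walk u v),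
        IsDifferencePreserving k P ∧
        (2 : ℝ) ^ ((pathDim k i : ℝ) - (2 + k) * i - c) ≤ (P.length : ℝ) := by
  obtain ⟨i₀, hi₀⟩ := Filter.eventually_atTop.1 (eventually_exists_long_isDifferencePreserving hk)
  -- `2 * k` pays for the frames and `1` for the halving in `2 ^ m ≤ 2 * P.length`. `pathDim k i₀`
  -- makes the exponent nonpositive for `i ≤ i₀`, where a single edge suffices.
  refine ⟨pathDim k i₀ + 2 * k + 1, fun i hi => ?_⟩
  rcases le_total i₀ i with h | h
  · obtain ⟨m, hm, u, v, P, hP, hlen⟩ := hi₀ i h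
    refine ⟨u, v, P, hP, ?_⟩
    have hmR : (m : ℝ) + (k + (k + 2) * i + k) = pathDim k i := by exact_mod_cast hm
    have hlenR : (2 : ℝ) ^ m ≤ 2 * P.length := by exact_mod_cast hlen
    have h0 : (0 : ℝ) ≤ pathDim k i₀ := Nat.cast_nonneg _
    calc (2 : ℝ) ^ ((pathDim k i : ℝ) - (2 + k) * i - (pathDim k i₀ + 2 * k + 1))
        ≤ (2 : ℝ) ^ ((m : ℝ) - 1) := by
          refine Real.rpow_le_rpow_of_exponent_le (by norm_num) ?_
          rw [← hmR]
          linarith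
      _ = 2 ^ m / 2 := by rw [Real.rpow_sub (by norm_num), Real.rpow_natCast, Real.rpow_one]
      _ ≤ P.length := by linarith
  · obtain ⟨u, v, P, hP, hlen⟩ := exists_isDifferencePreserving_length_one (d := pathDim k i) hk
      (by
        have := Nat.one_le_two_pow (n := i)
        rw [pathDim]
        omega)
    refine ⟨u, v, P, hP, ?_⟩
    have hpow : 2 ^ i ≤ 2 ^ i₀ := Nat.pow_le_pow_right (by norm_num) h
    have hle : pathDim k i ≤ pathDim k i₀ := by rw [pathDim, pathDim]; omega
    have hleR : (pathDim k i : ℝ) ≤ pathDim k i₀ := by exact_mod_cast hle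
    rw [hlen, Nat.cast_one]
    refine Real.rpow_le_one_of_one_le_of_nonpos (by norm_num) ?_
    have : (0 : ℝ) ≤ (2 + k) * i := by positivity
    have : (0 : ℝ) ≤ k := by positivity
    linarith

theorem circuitDim_eq_pathDim_add {k : ℕ} (hk : 1 ≤ k) (i : ℕ) :
    circuitDim k i = pathDim k i + k := by
  have := Nat.one_le_two_pow (n := i)
  rw [circuitDim, pathDim]
  omega

theorem strictMono_circuitDim {k : ℕ} (hk : 1 ≤ k) : StrictMono (circuitDim k) := by
  refine strictMono_nat_of_lt_succ fun i => ?_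
  rw [circuitDim, circuitDim, pow_succ]
  omega

theorem IsDifferencePreserving.two_mul_le_K {k : ℕ} (hk : 1 ≤ k) (i : ℕ)
    {u v : Fin (pathDim k i) → ZMod 2} {P : (hypercube (pathDim k i)).Walk u v}
    (hP : IsDifferencePreserving k P) (hN : 1 ≤ P.length) :
    2 * (P.length + k) ≤ K (circuitDim k i) k := by
  obtain ⟨τ, hτ⟩ := exists_transitionSeq P
  obtain ⟨C, hC, -, hlen⟩ := hP.exists_isCircuitCode hk hN hτ
  rw [circuitDim_eq_pathDim_add hk, ← hlen]
  exact le_K hC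

theorem tendsto_logb_K_div {k : ℕ} (hk : 1 ≤ k) :
    Filter.Tendsto (fun i : ℕ => Real.logb 2 (K (circuitDim k i) k) / (circuitDim k i : ℝ))
      Filter.atTop (nhds 1) := by
  obtain ⟨c, hc⟩ := exists_const_forall_isDifferencePreserving hk
  have hdim : ∀ i, (2 : ℝ) ^ i ≤ circuitDim k i := by
    intro i
    have : 2 ^ i ≤ circuitDim k i := by rw [circuitDim]; omega
    exact_mod_cast this
  have hlim : Filter.Tendsto
      (fun i : ℕ => 1 - ((2 + k : ℝ) * ((i : ℝ) ^ 1 / 2 ^ i) + (k + |c|) * ((i : ℝ) ^ 0 / 2 ^ i)))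
      Filter.atTop (nhds 1) := by
    have h1 := tendsto_pow_const_div_const_pow_of_one_lt 1 (show (1 : ℝ) < 2 by norm_num)
    have h0 := tendsto_pow_const_div_const_pow_of_one_lt 0 (show (1 : ℝ) < 2 by norm_num)
    simpa using ((h1.const_mul (2 + k : ℝ)).add (h0.const_mul (k + |c|))).const_sub 1
  refine tendsto_of_tendsto_of_tendsto_of_le_of_le' hlim tendsto_const_nhds ?_ ?_
  · filter_upwards [Filter.eventually_ge_atTop 1] with i hi
    obtain ⟨u, v, P, hP, hlen⟩ := hc i hi
    have hD : (0 : ℝ) < circuitDim k i := lt_of_lt_of_le (by positivity) (hdim i)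
    have hPpos : (0 : ℝ) < P.length := lt_of_lt_of_le (by positivity) hlen
    have hN : 1 ≤ P.length := by exact_mod_cast hPpos
    have hK := hP.two_mul_le_K hk i hN
    have hKle : P.length ≤ K (circuitDim k i) k := by omega
    have hKR : (P.length : ℝ) ≤ K (circuitDim k i) k := by exact_mod_cast hKle
    have hlog : (pathDim k i : ℝ) - (2 + k) * i - c ≤ Real.logb 2 (K (circuitDim k i) k) :=
      (Real.le_logb_iff_rpow_le (by norm_num) (hPpos.trans_le hKR)).2 (hlen.trans hKR)
    have hdimR : (circuitDim k i : ℝ) = pathDim k i + k := by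
      exact_mod_cast circuitDim_eq_pathDim_add hk i
    rw [le_div_iff₀ hD]
    have hE : (2 + k : ℝ) * ((i : ℝ) ^ 1 / 2 ^ i) + (k + |c|) * ((i : ℝ) ^ 0 / 2 ^ i) =
        ((2 + k : ℝ) * i + (k + |c|)) / 2 ^ i := by
      rw [pow_one, pow_zero]
      ring
    have hA : (0 : ℝ) ≤ (2 + k : ℝ) * i + (k + |c|) := by positivity
    have hB : (2 + k : ℝ) * i + (k + |c|) ≤
        ((2 + k : ℝ) * i + (k + |c|)) / 2 ^ i * circuitDim k i := by
      rw [div_mul_eq_mul_div, le_div_iff₀ (by positivity)]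
      exact mul_le_mul_of_nonneg_left (hdim i) hA
    rw [hE, sub_mul, one_mul]
    have := le_abs_self c
    linarith
  · refine Filter.Eventually.of_forall fun i => ?_
    have hD : (0 : ℝ) < circuitDim k i := lt_of_lt_of_le (by positivity) (hdim i)
    rw [div_le_one hD]
    -- When `K` is zero its logarithm has the default value `0`, so the upper bound still holds.
    rcases Nat.eq_zero_or_pos (K (circuitDim k i) k) with h0 | hpos
    · rw [h0, Nat.cast_zero, Real.logb_zero]
      exact hD.le
    · rw [Real.logb_le_iff_le_rpow (by norm_num) (by exact_mod_cast hpos), Real.rpow_natCast]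
      exact_mod_cast K_le _ k

end CircuitCode

theorem mainTheorem3 (k : ℕ) (hk : 1 ≤ k) :
    -- long difference-preserving codes in dimension `d_i - k`
    (∃ c : ℝ, ∀ i : ℕ, 1 ≤ i →
      ∃ (u v : Fin (CircuitCode.pathDim k i) → ZMod 2)
        (P : (CircuitCode.hypercube (CircuitCode.pathDim k i)).Walk u v),
        CircuitCode.IsDifferencePreserving k P ∧
        (2 : ℝ) ^ ((CircuitCode.pathDim k i : ℝ) - (2 + k) * i - c) ≤ (P.length : ℝ)) ∧
    -- their extension to circuit codes in dimension `d_i`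
    (∀ i : ℕ, 1 ≤ i → CircuitCode.circuitDim k i = CircuitCode.pathDim k i + k ∧
      ∀ (u v : Fin (CircuitCode.pathDim k i) → ZMod 2)
        (P : (CircuitCode.hypercube (CircuitCode.pathDim k i)).Walk u v)
        (τ : List (Fin (CircuitCode.pathDim k i))),
        CircuitCode.IsDifferencePreserving k P → 1 ≤ P.length →
        CircuitCode.IsTransitionSeq P τ →
        (∃ C : (CircuitCode.hypercube (CircuitCode.pathDim k i + k)).Walk 0 0,
          CircuitCode.IsCircuitCode k C ∧
          CircuitCode.IsTransitionSeq C
            (CircuitCode.appendNew k τ ++ CircuitCode.appendNew k τ) ∧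
          C.length = 2 * (P.length + k)) ∧
        2 * (P.length + k) ≤ CircuitCode.K (CircuitCode.circuitDim k i) k) ∧
    -- the limit along the subsequence
    StrictMono (CircuitCode.circuitDim k) ∧
    Filter.Tendsto
      (fun i : ℕ => Real.logb 2 (CircuitCode.K (CircuitCode.circuitDim k i) k) /
        (CircuitCode.circuitDim k i : ℝ))
      Filter.atTop (nhds 1) := by
  refine ⟨CircuitCode.exists_const_forall_isDifferencePreserving hk, fun i _ =>
    ⟨CircuitCode.circuitDim_eq_pathDim_add hk i, fun u v P τ hP hN hτ =>
      ⟨hP.exists_isCircuitCode hk hN hτ, hP.two_mul_le_K hk i hN⟩⟩,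
    CircuitCode.strictMono_circuitDim hk, CircuitCode.tendsto_logb_K_div hk⟩
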